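/- Let $(M,g_R)$ be a connected, complete (smooth, finite-dimensional, Hausdorff, boundaryless) Riemannian manifold, let $x_0\in M$, and let $d_R(x)$ denote the $g_R$-distance from $x_0$ to $x$. Here a Riemannian metric is called complete if its Riemannian distance is a complete metric on $M$. Write $\Vert\cdot\Vert_R$ and $\Vert\cdot\Vert_h$ for the pointwise norms of Riemannian metrics $g_R$ and $h$ on $M$. Let $\varphi:[0,\infty)\to(0,\infty)$ be a locally Lipschitz function that is primarily complete, i.e. $\int_0^\infty \frac{dr}{\varphi(r)}=\infty$. If $h$ is a Riemannian metric on $M$ satisfying $$\Vert v_x\Vert_h\ \geq\ \frac{\Vert v_x\Vert_R}{\varphi(d_R(x))}\qquad\text{for all } x\in M,\ v_x\in T_xM,$$ then $h$ is complete. In particular, this occurs when the bounding function grows at most linearly: if $\varphi:[0,\infty)\to(0,\infty)$ is locally Lipschitz and $\varphi(r)\le a+b\,r$ for all $r\ge 0$, with constants $a,b\ge 0$ (so that in fact $a\geq\varphi(0)>0$), then $\varphi$ is primarily complete, the bound above for $\varphi$ implies $$\Vert v_x\Vert_h\ \geq\ \frac{\Vert v_x\Vert_R}{a+b\,d_R(x)}\qquad\text{for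 all } x\in M,\ v_x\in T_xM,$$ and every Riemannian metric $h$ on $M$ satisfying this last inequality is complete. -/

import Mathlib

open scoped Manifold ContDiff ENNReal Topology
open Set Filter MeasureTheory Bundle

noncomputable section

/-- A smooth (`C^∞`) Riemannian metric on a smooth manifold `M` without boundary, modelled on
the finite-dimensional space `E`. -/
abbrev SmoothRiemannianMetric (E : Type*) [NormedAddCommGroup E] [NormedSpace ℝ E]
    (M : Type*) [TopologicalSpace M] [ChartedSpace E M] [IsManifold 𝓘(ℝ, E) ∞ M] :=
  ContMDiffRiemannianMetric 𝓘(ℝ, E) ∞ E (fun x : M => TangentSpace 𝓘(ℝ, E) x)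

namespace SmoothRiemannianMetric

variable {E : Type*} [NormedAddCommGroup E] [NormedSpace ℝ E]
  {M : Type*} [TopologicalSpace M] [ChartedSpace E M] [IsManifold 𝓘(ℝ, E) ∞ M]

/-- The pointwise norm `‖v‖_g = √(g_x(v, v))` of a tangent vector `v ∈ T_x M`. -/
def tangentNorm (g : SmoothRiemannianMetric E M) {x : M} (v : TangentSpace 𝓘(ℝ, E) x) : ℝ :=
  √(g.inner x v v)

/-- The Riemannian distance of `g`, with values in `[0, ∞]`: the infimum of the `g`-lengths of
the `C^1` paths from `x` to `y` (so it is `∞` when there is no such path). -/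
def riemEDist (g : SmoothRiemannianMetric E M) (x y : M) : ℝ≥0∞ :=
  letI : RiemannianBundle (fun x : M => TangentSpace 𝓘(ℝ, E) x) := ⟨g.toRiemannianMetric⟩
  Manifold.riemannianEDist 𝓘(ℝ, E) x y

/-- The Riemannian distance of `g` as a real number; on a connected manifold `riemEDist` is
finite, so nothing is lost there. -/
def riemDist (g : SmoothRiemannianMetric E M) (x y : M) : ℝ :=
  (g.riemEDist x y).toReal

/-- `g` is complete: every Cauchy sequence for the Riemannian distance of `g` converges for the
Riemannian distance of `g`. -/
def IsComplete (g : SmoothRiemannianMetric E M) : Prop :=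
  ∀ u : ℕ → M,
    (∀ ε : ℝ≥0∞, 0 < ε → ∃ N : ℕ, ∀ m ≥ N, ∀ n ≥ N, g.riemEDist (u m) (u n) < ε) →
    ∃ x : M, Tendsto (fun n => g.riemEDist (u n) x) atTop (𝓝 0)

/-- The lower bound `‖v_x‖_h ≥ ‖v_x‖_R / φ(d_R(x₀, x))` for all `x ∈ M` and `v_x ∈ T_x M`. -/
def IsLowerlyBounded (h gR : SmoothRiemannianMetric E M) (x₀ : M) (φ : ℝ → ℝ) : Prop :=
  ∀ (x : M) (v : TangentSpace 𝓘(ℝ, E) x),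
    h.tangentNorm v ≥ gR.tangentNorm v / φ (gR.riemDist x₀ x)

end SmoothRiemannianMetric

/-- `φ` restricts to a locally Lipschitz function `[0, ∞) → (0, ∞)`; its values on negative
numbers are irrelevant. -/
structure IsBoundingFunction (φ : ℝ → ℝ) : Prop where
  pos : ∀ r : ℝ, 0 ≤ r → 0 < φ r
  locallyLipschitz : LocallyLipschitzOn (Ici (0 : ℝ)) φ

/-- `φ` is primarily complete: `∫₀^∞ dr / φ(r) = ∞`. -/
def IsPrimarilyComplete (φ : ℝ → ℝ) : Prop :=
  ∫⁻ r in Ici (0 : ℝ), ENNReal.ofReal (1 / φ r) = ⊤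

end

/-! Along a path, `d_R` changes at rate at most `‖γ'‖_R ≤ φ(d_R) ‖γ'‖_h`, so the integral of `1 / φ`
between the endpoint values of `d_R` is controlled by the `h`-length. Differentiating `d_R` is
avoided by cutting the path into pieces on which `φ ∘ d_R` varies by a factor at most 2; this costs
a harmless factor 2 (`lintegral_le_riemEDist`).

As `∫ dr / φ` diverges, `h`-bounded sets are `d_R`-bounded. There `φ ≤ C`, so `gR`-lengths are at
most `C` times `h`-lengths (`length_le`), and an `h`-Cauchy sequence is `gR`-Cauchy. Its `gR`-limit
is an `h`-limit, since both distances induce the topology of `M`. -/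

noncomputable section

namespace SmoothRiemannianMetric

variable {E : Type*} [NormedAddCommGroup E] [NormedSpace ℝ E]
  {M : Type*} [TopologicalSpace M] [ChartedSpace E M] [IsManifold 𝓘(ℝ, E) ∞ M]

/-! ### Length and distance of a single metric. -/

/-- The `g`-length of the path `γ` between the times `a` and `b`. -/
def length (g : SmoothRiemannianMetric E M) (γ : ℝ → M) (a b : ℝ) : ℝ≥0∞ :=
  letI : RiemannianBundle (fun x : M => TangentSpace 𝓘(ℝ, E) x) := ⟨g.toRiemannianMetric⟩
  Manifold.pathELength 𝓘(ℝ, E) γ a b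

theorem length_eq_lintegral (g : SmoothRiemannianMetric E M) (γ : ℝ → M) (a b : ℝ) :
    g.length γ a b =
      ∫⁻ t in Icc a b, ENNReal.ofReal (g.tangentNorm (mfderiv 𝓘(ℝ, ℝ) 𝓘(ℝ, E) γ t 1)) := by
  let : RiemannianBundle (fun x : M => TangentSpace 𝓘(ℝ, E) x) := ⟨g.toRiemannianMetric⟩
  rw [length, Manifold.pathELength_eq_lintegral_mfderiv_Icc]
  refine lintegral_congr fun t => ?_
  rw [← ofReal_norm, norm_eq_sqrt_real_inner]
  rfl

theorem length_add (g : SmoothRiemannianMetric E M) (γ : ℝ → M) {a b c : ℝ}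
    (hab : a ≤ b) (hbc : b ≤ c) : g.length γ a b + g.length γ b c = g.length γ a c :=
  let : RiemannianBundle (fun x : M => TangentSpace 𝓘(ℝ, E) x) := ⟨g.toRiemannianMetric⟩
  Manifold.pathELength_add hab hbc

theorem length_mono (g : SmoothRiemannianMetric E M) (γ : ℝ → M) {a b a' b' : ℝ}
    (ha : a' ≤ a) (hb : b ≤ b') : g.length γ a b ≤ g.length γ a' b' :=
  let : RiemannianBundle (fun x : M => TangentSpace 𝓘(ℝ, E) x) := ⟨g.toRiemannianMetric⟩
  Manifold.pathELength_mono ha hb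

theorem riemEDist_le_length (g : SmoothRiemannianMetric E M) {γ : ℝ → M}
    (hγ : ContMDiff 𝓘(ℝ, ℝ) 𝓘(ℝ, E) 1 γ) {a b : ℝ} (hab : a ≤ b) :
    g.riemEDist (γ a) (γ b) ≤ g.length γ a b :=
  let : RiemannianBundle (fun x : M => TangentSpace 𝓘(ℝ, E) x) := ⟨g.toRiemannianMetric⟩
  Manifold.riemannianEDist_le_pathELength hγ.contMDiffOn rfl rfl hab

theorem exists_length_lt (g : SmoothRiemannianMetric E M) {x y : M} {r : ℝ≥0∞}
    (hr : g.riemEDist x y < r) :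
    ∃ γ : ℝ → M, γ 0 = x ∧ γ 1 = y ∧ ContMDiff 𝓘(ℝ, ℝ) 𝓘(ℝ, E) 1 γ ∧ g.length γ 0 1 < r := by
  let : RiemannianBundle (fun x : M => TangentSpace 𝓘(ℝ, E) x) := ⟨g.toRiemannianMetric⟩
  obtain ⟨γ, h0, h1, hγ, hl, -⟩ :=
    Manifold.exists_lt_locally_constant_of_riemannianEDist_lt hr zero_lt_one
  exact ⟨γ, h0, h1, hγ, hl⟩

theorem riemEDist_comm (g : SmoothRiemannianMetric E M) (x y : M) :
    g.riemEDist x y = g.riemEDist y x :=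
  let : RiemannianBundle (fun x : M => TangentSpace 𝓘(ℝ, E) x) := ⟨g.toRiemannianMetric⟩
  Manifold.riemannianEDist_comm

theorem riemEDist_triangle (g : SmoothRiemannianMetric E M) (x y z : M) :
    g.riemEDist x z ≤ g.riemEDist x y + g.riemEDist y z :=
  let : RiemannianBundle (fun x : M => TangentSpace 𝓘(ℝ, E) x) := ⟨g.toRiemannianMetric⟩
  Manifold.riemannianEDist_triangle

/-- The emetric space structure given by the Riemannian distance of `g`; its topology is
definitionally the given one. -/
@[reducible] def emetricSpace [T3Space M] (g : SmoothRiemannianMetric E M) : EMetricSpace M :=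
  letI : RiemannianBundle (fun x : M => TangentSpace 𝓘(ℝ, E) x) := ⟨g.toRiemannianMetric⟩
  haveI : IsContinuousRiemannianBundle E (fun x : M => TangentSpace 𝓘(ℝ, E) x) :=
    ⟨g.inner, g.contMDiff.continuous, fun _ _ _ => rfl⟩
  EMetricSpace.ofRiemannianMetric 𝓘(ℝ, E) M

theorem tendsto_riemEDist_iff [T3Space M] (g : SmoothRiemannianMetric E M) {u : ℕ → M} {x : M} :
    Tendsto (fun n => g.riemEDist (u n) x) atTop (𝓝 0) ↔ Tendsto u atTop (𝓝 x) := by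
  let := g.emetricSpace
  exact (tendsto_iff_edist_tendsto_0 (l := atTop) (f := u) (y := x)).symm

theorem riemEDist_ne_top [T3Space M] [PreconnectedSpace M] (g : SmoothRiemannianMetric E M)
    (x y : M) : g.riemEDist x y ≠ ⊤ := by
  let := g.emetricSpace
  have hball : Metric.eball x ⊤ = univ :=
    IsClopen.eq_univ ⟨Metric.isClosed_eball_top, Metric.isOpen_eball⟩
      ⟨x, Metric.mem_eball_self ENNReal.zero_lt_top⟩
  have hy : y ∈ Metric.eball x ⊤ := hball ▸ mem_univ y
  exact (Metric.mem_eball'.1 hy).ne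

theorem continuous_riemDist [T3Space M] [PreconnectedSpace M] (g : SmoothRiemannianMetric E M)
    (x : M) : Continuous (g.riemDist x) := by
  let := g.emetricSpace
  have h : Continuous fun y : M => edist x y := continuous_const.edist continuous_id
  exact ENNReal.continuousOn_toReal.comp_continuous h (g.riemEDist_ne_top x)

theorem riemDist_nonneg (g : SmoothRiemannianMetric E M) (x y : M) : 0 ≤ g.riemDist x y :=
  ENNReal.toReal_nonneg

theorem ofReal_riemDist_sub_le [T3Space M] [PreconnectedSpace M] (g : SmoothRiemannianMetric E M)
    (x y z : M) : ENNReal.ofReal (g.riemDist x z - g.riemDist x y) ≤ g.riemEDist y z := by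
  rw [riemDist, riemDist, ENNReal.ofReal_sub _ ENNReal.toReal_nonneg,
    ENNReal.ofReal_toReal (g.riemEDist_ne_top x z), ENNReal.ofReal_toReal (g.riemEDist_ne_top x y)]
  exact tsub_le_iff_left.2 (g.riemEDist_triangle x y z)

theorem tangentNorm_nonneg (g : SmoothRiemannianMetric E M) {x : M}
    (v : TangentSpace 𝓘(ℝ, E) x) : 0 ≤ g.tangentNorm v :=
  Real.sqrt_nonneg _

/-! ### Comparison of the two metrics along paths. -/

section LowerBound

variable {h gR : SmoothRiemannianMetric E M} {x₀ : M} {φ : ℝ → ℝ}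

/-- A lower bound by `φ` becomes a lower bound by a larger function. -/
theorem IsLowerlyBounded.mono (hb : h.IsLowerlyBounded gR x₀ φ) (hφ : ∀ r, 0 ≤ r → 0 < φ r)
    {ψ : ℝ → ℝ} (hψ : ∀ r, 0 ≤ r → φ r ≤ ψ r) : h.IsLowerlyBounded gR x₀ ψ := fun x v =>
  (div_le_div_of_nonneg_left (gR.tangentNorm_nonneg v) (hφ _ (gR.riemDist_nonneg _ _))
    (hψ _ (gR.riemDist_nonneg _ _))).trans (hb x v)

/-- Where `φ` is at most `C`, lengths for `gR` are at most `C` times lengths for `h`. -/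
theorem IsLowerlyBounded.length_le (hb : h.IsLowerlyBounded gR x₀ φ)
    (hφ : ∀ r, 0 ≤ r → 0 < φ r) {γ : ℝ → M} {a b C : ℝ}
    (hC : ∀ t ∈ Icc a b, φ (gR.riemDist x₀ (γ t)) ≤ C) :
    gR.length γ a b ≤ ENNReal.ofReal C * h.length γ a b := by
  rw [length_eq_lintegral, length_eq_lintegral, ← lintegral_const_mul' _ _ ENNReal.ofReal_ne_top]
  refine setLIntegral_mono' measurableSet_Icc fun t ht => ?_
  have hpos := hφ _ (gR.riemDist_nonneg x₀ (γ t))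
  rw [← ENNReal.ofReal_mul (hpos.le.trans (hC t ht))]
  refine ENNReal.ofReal_le_ofReal ?_
  have h1 := (div_le_iff₀ hpos).1 (hb (γ t) (mfderiv 𝓘(ℝ, ℝ) 𝓘(ℝ, E) γ t 1))
  rw [mul_comm] at h1
  exact h1.trans (mul_le_mul_of_nonneg_right (hC t ht) (h.tangentNorm_nonneg _))

variable [T3Space M] [PreconnectedSpace M]

/-- Every value of `d_R` in the interval is attained on the path, so `1 / φ ≤ 2 / C` there, while
`d_R` grows by at most `C` times the `h`-length; `C` cancels. -/
theorem IsLowerlyBounded.lintegral_le_of_oscillation (hb : h.IsLowerlyBounded gR x₀ φ)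
    (hφ : ∀ r, 0 ≤ r → 0 < φ r) {γ : ℝ → M} (hγ : ContMDiff 𝓘(ℝ, ℝ) 𝓘(ℝ, E) 1 γ)
    {a b C : ℝ} (hab : a ≤ b) (hC0 : 0 < C)
    (hC : ∀ t ∈ Icc a b, φ (gR.riemDist x₀ (γ t)) ∈ Icc (C / 2) C) :
    ∫⁻ r in Ioc (gR.riemDist x₀ (γ a)) (gR.riemDist x₀ (γ b)), ENNReal.ofReal (1 / φ r) ≤
      2 * h.length γ a b := by
  have hivt := intermediate_value_Icc hab
    ((gR.continuous_riemDist x₀).comp hγ.continuous).continuousOn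
  calc
    _ ≤ ∫⁻ _ in Ioc (gR.riemDist x₀ (γ a)) (gR.riemDist x₀ (γ b)), ENNReal.ofReal (2 / C) := by
      refine setLIntegral_mono' measurableSet_Ioc fun r hr => ENNReal.ofReal_le_ofReal ?_
      obtain ⟨t, ht, rfl⟩ := hivt (Ioc_subset_Icc_self hr)
      have h2 := (hC t ht).1
      rw [show 2 / C = 1 / (C / 2) by field_simp]
      exact one_div_le_one_div_of_le (by positivity) h2
    _ = ENNReal.ofReal (2 / C) *
        ENNReal.ofReal (gR.riemDist x₀ (γ b) - gR.riemDist x₀ (γ a)) := by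
      rw [setLIntegral_const, Real.volume_Ioc]
    _ ≤ ENNReal.ofReal (2 / C) * (ENNReal.ofReal C * h.length γ a b) := by
      gcongr
      exact (gR.ofReal_riemDist_sub_le _ _ _).trans ((gR.riemEDist_le_length hγ hab).trans
        (hb.length_le hφ fun t ht => (hC t ht).2))
    _ = 2 * h.length γ a b := by
      rw [← mul_assoc, ← ENNReal.ofReal_mul (by positivity), div_mul_cancel₀ _ hC0.ne']
      simp

/-- The `1 / φ`-length of the interval between the values of the distance function at the
endpoints of a path is bounded by twice the `h`-length of the path. -/
theorem IsLowerlyBounded.lintegral_le_length (hb : h.IsLowerlyBounded gR x₀ φ)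
    (hφ : ∀ r, 0 ≤ r → 0 < φ r) (hφc : ContinuousOn φ (Ici 0))
    {γ : ℝ → M} (hγ : ContMDiff 𝓘(ℝ, ℝ) 𝓘(ℝ, E) 1 γ) :
    ∫⁻ r in Ioc (gR.riemDist x₀ (γ 0)) (gR.riemDist x₀ (γ 1)), ENNReal.ofReal (1 / φ r) ≤
      2 * h.length γ 0 1 := by
  set ψ : ℝ → ℝ := fun t => φ (gR.riemDist x₀ (γ t)) with hψ
  have hψc : Continuous ψ :=
    hφc.comp_continuous ((gR.continuous_riemDist x₀).comp hγ.continuous)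
      fun t => gR.riemDist_nonneg _ _
  have hψpos : ∀ t, 0 < ψ t := fun t => hφ _ (gR.riemDist_nonneg _ _)
  obtain ⟨t₀, -, ht₀⟩ := isCompact_Icc.exists_isMinOn (nonempty_Icc.2 zero_le_one)
    (hψc.continuousOn (s := Icc (0 : ℝ) 1))
  -- With oscillation below a third of the minimum, `ψ` stays between `2/3 * ψ s` and `4/3 * ψ s` on
  -- each piece, which is `[C / 2, C]` for `C = 4/3 * ψ s`.
  obtain ⟨δ, hδ, hδψ⟩ := Metric.uniformContinuousOn_iff.1
    (isCompact_Icc.uniformContinuousOn_of_continuous (hψc.continuousOn (s := Icc (0 : ℝ) 1)))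
    (ψ t₀ / 3) (by have := hψpos t₀; positivity)
  obtain ⟨n, hn⟩ := exists_nat_one_div_lt hδ
  have hn0 : (0 : ℝ) < n + 1 := by positivity
  have key : ∀ k : ℕ, k ≤ n + 1 →
      ∫⁻ r in Ioc (gR.riemDist x₀ (γ 0)) (gR.riemDist x₀ (γ (k / (n + 1)))),
        ENNReal.ofReal (1 / φ r) ≤ 2 * h.length γ 0 (k / (n + 1)) := by
    intro k
    induction k with
    | zero => simp
    | succ k ih =>
      intro hk
      have hk' : (k : ℝ) + 1 ≤ n + 1 := by exact_mod_cast hk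
      push_cast
      set s : ℝ := k / (n + 1) with hs
      set t : ℝ := (k + 1) / (n + 1) with ht
      have hs0 : 0 ≤ s := by positivity
      have ht1 : t ≤ 1 := (div_le_one hn0).2 hk'
      have hts : t - s = 1 / (n + 1) := by rw [hs, ht]; field_simp; ring
      have hst : s ≤ t := by
        have : 0 < 1 / ((n : ℝ) + 1) := by positivity
        linarith
      have hstep : ∫⁻ r in Ioc (gR.riemDist x₀ (γ s)) (gR.riemDist x₀ (γ t)),
          ENNReal.ofReal (1 / φ r) ≤ 2 * h.length γ s t := by
        refine hb.lintegral_le_of_oscillation hφ hγ hst (C := 4 / 3 * ψ s)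
          (mul_pos (by norm_num) (hψpos s)) fun τ hτ => ?_
        have hsI : s ∈ Icc (0 : ℝ) 1 := ⟨hs0, hst.trans ht1⟩
        have hdist : dist τ s < δ := by
          rw [Real.dist_eq, abs_of_nonneg (sub_nonneg.2 hτ.1)]
          linarith [hτ.2]
        have h1 := hδψ τ ⟨hs0.trans hτ.1, hτ.2.trans ht1⟩ s hsI hdist
        rw [Real.dist_eq, abs_lt] at h1
        have h2 : ψ t₀ ≤ ψ s := ht₀ hsI
        change ψ τ ∈ _
        constructor <;> linarith [h1.1, h1.2]
      calc
        _ ≤ ∫⁻ r in Ioc (gR.riemDist x₀ (γ 0)) (gR.riemDist x₀ (γ s)) ∪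
              Ioc (gR.riemDist x₀ (γ s)) (gR.riemDist x₀ (γ t)), ENNReal.ofReal (1 / φ r) :=
          lintegral_mono_set Ioc_subset_Ioc_union_Ioc
        _ ≤ 2 * h.length γ 0 s + 2 * h.length γ s t :=
          (lintegral_union_le _ _ _).trans (add_le_add (ih (Nat.le_of_succ_le hk)) hstep)
        _ = 2 * h.length γ 0 t := by rw [← mul_add, h.length_add γ hs0 hst]
  have := key (n + 1) le_rfl
  push_cast at this
  rwa [div_self hn0.ne'] at this

theorem IsLowerlyBounded.lintegral_le_riemEDist (hb : h.IsLowerlyBounded gR x₀ φ)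
    (hφ : ∀ r, 0 ≤ r → 0 < φ r) (hφc : ContinuousOn φ (Ici 0)) (x y : M) :
    ∫⁻ r in Ioc (gR.riemDist x₀ x) (gR.riemDist x₀ y), ENNReal.ofReal (1 / φ r) ≤
      2 * h.riemEDist x y := by
  rw [mul_comm, ← ENNReal.div_le_iff_le_mul (by simp) (by simp)]
  refine le_of_forall_gt fun r hr => ?_
  obtain ⟨γ, rfl, rfl, hγ, hl⟩ := h.exists_length_lt hr
  refine lt_of_le_of_lt ?_ hl
  rw [ENNReal.div_le_iff_le_mul (by simp) (by simp), mul_comm]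
  exact hb.lintegral_le_length hφ hφc hγ

end LowerBound

end SmoothRiemannianMetric

/-! ### Divergence of the integral of `1 / φ`. -/

/-- If `∫₀^∞ dr / φ(r) = ∞`, then the integrals of `1 / φ` over the intervals `(s, R]` are
unbounded. -/
theorem IsPrimarilyComplete.exists_lt_lintegral {φ : ℝ → ℝ} (hint : IsPrimarilyComplete φ)
    (hφ : ∀ r, 0 ≤ r → 0 < φ r) (hφc : ContinuousOn φ (Ici 0)) (s : ℝ) {c : ℝ≥0∞} (hc : c < ⊤) :
    ∃ R, c < ∫⁻ r in Ioc s R, ENNReal.ofReal (1 / φ r) := by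
  have hfin : ∫⁻ r in Icc 0 s, ENNReal.ofReal (1 / φ r) < ⊤ := by
    have hcont : ContinuousOn (fun r => 1 / φ r) (Icc 0 s) :=
      continuousOn_const.div (hφc.mono Icc_subset_Ici_self) fun r hr => (hφ r hr.1).ne'
    exact (hcont.integrableOn_compact isCompact_Icc).lintegral_lt_top
  have htop : ∫⁻ r in Ioi s, ENNReal.ofReal (1 / φ r) = ⊤ := by
    by_contra hne
    have : ∫⁻ r in Ici 0, ENNReal.ofReal (1 / φ r) ≤ _ :=
      (lintegral_mono_set (t := Icc 0 s ∪ Ioi s) fun r (hr : 0 ≤ r) =>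
        (le_or_gt r s).imp (fun h => ⟨hr, h⟩) id).trans (lintegral_union_le _ _ _)
    rw [hint] at this
    exact (ENNReal.add_lt_top.2 ⟨hfin, lt_top_iff_ne_top.2 hne⟩).not_ge this
  have hmono : Monotone fun n : ℕ => Ioc s (n : ℝ) := fun m n hmn =>
    Ioc_subset_Ioc_right (by exact_mod_cast hmn)
  have hUnion : ⋃ n : ℕ, Ioc s (n : ℝ) = Ioi s := by
    ext r
    simpa using fun _ => exists_nat_ge r
  rw [← hUnion, setLIntegral_iUnion_of_directed _ hmono.directed_le] at htop
  obtain ⟨n, hn⟩ := lt_iSup_iff.1 (htop ▸ hc)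
  exact ⟨n, hn⟩

/-- A positive function on `[0, ∞)` with at most linear growth is primarily complete. -/
theorem isPrimarilyComplete_of_le_linear {φ : ℝ → ℝ} (hφ : ∀ r, 0 ≤ r → 0 < φ r) {a b : ℝ}
    (ha : 0 ≤ a) (hb : 0 ≤ b) (hle : ∀ r, 0 ≤ r → φ r ≤ a + b * r) : IsPrimarilyComplete φ := by
  have ha0 : 0 < a := by simpa using (hφ 0 le_rfl).trans_le (hle 0 le_rfl)
  have hab : 0 < a + b := by positivity
  by_contra hne
  -- For `r > 1`, `φ r ≤ a + b * r ≤ (a + b) * r`, so `1 / φ` dominates a multiple of `1 / r`.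
  refine not_integrableOn_Ioi_inv (a := 1) ⟨measurable_inv.aestronglyMeasurable, ?_⟩
  have hbound : ∫⁻ r in Ioi (1 : ℝ), ‖r⁻¹‖ₑ ≤
      ENNReal.ofReal (a + b) * ∫⁻ r in Ici (0 : ℝ), ENNReal.ofReal (1 / φ r) := by
    rw [← lintegral_const_mul' _ _ ENNReal.ofReal_ne_top]
    refine (setLIntegral_mono' measurableSet_Ioi fun r (hr : 1 < r) => ?_).trans
      (lintegral_mono_set fun r (hr : 1 < r) => zero_le_one.trans hr.le)
    have hr0 : 0 < r := zero_lt_one.trans hr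
    rw [Real.enorm_of_nonneg (by positivity), ← ENNReal.ofReal_mul hab.le]
    refine ENNReal.ofReal_le_ofReal ?_
    rw [mul_one_div, inv_eq_one_div, div_le_div_iff₀ hr0 (hφ r hr0.le)]
    nlinarith [hle r hr0.le]
  exact hbound.trans_lt (ENNReal.mul_lt_top ENNReal.ofReal_lt_top (lt_top_iff_ne_top.2 hne))

/-! ### Completeness of `h`. -/

namespace SmoothRiemannianMetric

variable {E : Type*} [NormedAddCommGroup E] [NormedSpace ℝ E]
  {M : Type*} [TopologicalSpace M] [ChartedSpace E M] [IsManifold 𝓘(ℝ, E) ∞ M]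

/-- A metric that is lowerly bounded through a primarily complete function is complete. -/
theorem IsLowerlyBounded.isComplete [T3Space M] [PreconnectedSpace M]
    {h gR : SmoothRiemannianMetric E M} {x₀ : M} {φ : ℝ → ℝ} (hb : h.IsLowerlyBounded gR x₀ φ)
    (hφ : ∀ r, 0 ≤ r → 0 < φ r) (hφc : ContinuousOn φ (Ici 0)) (hint : IsPrimarilyComplete φ)
    (hgR : gR.IsComplete) : h.IsComplete := by
  intro u hu
  -- Tail terms are within 1 of `u N`, so paths of `h`-length below 1 joining them stay within 2;
  -- the factor 2 of the integral bound turns this into 4.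
  obtain ⟨N, hN⟩ := hu 1 one_pos
  obtain ⟨R, hR⟩ := hint.exists_lt_lintegral hφ hφc (gR.riemDist x₀ (u N)) (c := 4)
    (by simp)
  have hbdd : ∀ y, h.riemEDist (u N) y ≤ 2 → gR.riemDist x₀ y ≤ R := by
    intro y hy
    by_contra! hlt
    have h1 : ∫⁻ r in Ioc (gR.riemDist x₀ (u N)) R, ENNReal.ofReal (1 / φ r) ≤ _ :=
      (lintegral_mono_set (Ioc_subset_Ioc_right hlt.le)).trans
        (hb.lintegral_le_riemEDist hφ hφc (u N) y)
    have h2 : 2 * h.riemEDist (u N) y ≤ 4 := by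
      calc 2 * h.riemEDist (u N) y ≤ 2 * 2 := by gcongr
        _ = 4 := by norm_num
    exact (hR.trans_le (h1.trans h2)).false
  obtain ⟨C, hC⟩ := (isCompact_Icc (a := (0 : ℝ)) (b := R)).bddAbove_image
    (hφc.mono Icc_subset_Ici_self)
  have hCle : ∀ y, h.riemEDist (u N) y ≤ 2 → φ (gR.riemDist x₀ y) ≤ C := fun y hy =>
    hC (mem_image_of_mem φ ⟨gR.riemDist_nonneg _ _, hbdd y hy⟩)
  have hcauchy : ∀ ε : ℝ≥0∞, 0 < ε → ∃ K : ℕ, ∀ m ≥ K, ∀ n ≥ K,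
      gR.riemEDist (u m) (u n) < ε := by
    intro ε hε
    -- The 1 keeps the joining path where `φ ≤ C`; the quotient makes its `gR`-length less than `ε`.
    obtain ⟨K, hK⟩ := hu (min 1 (ε / ENNReal.ofReal C))
      (lt_min one_pos (ENNReal.div_pos hε.ne' ENNReal.ofReal_ne_top))
    refine ⟨max K N, fun m hm n hn => ?_⟩
    obtain ⟨γ, h0, h1, hγ, hl⟩ := h.exists_length_lt
      (hK m ((le_max_left _ _).trans hm) n ((le_max_left _ _).trans hn))
    have hle : gR.length γ 0 1 ≤ ENNReal.ofReal C * h.length γ 0 1 := by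
      refine hb.length_le hφ fun t ht => hCle _ ?_
      calc h.riemEDist (u N) (γ t) ≤ h.riemEDist (u N) (u m) + h.riemEDist (u m) (γ t) :=
            h.riemEDist_triangle _ _ _
        _ ≤ 1 + 1 := by
          gcongr
          · exact (hN N le_rfl m ((le_max_right _ _).trans hm)).le
          · rw [← h0]
            exact (h.riemEDist_le_length hγ ht.1).trans
              ((h.length_mono γ le_rfl ht.2).trans (hl.le.trans (min_le_left _ _)))
        _ = 2 := one_add_one_eq_two
    rw [← h0, ← h1]
    calc gR.riemEDist (γ 0) (γ 1) ≤ gR.length γ 0 1 := gR.riemEDist_le_length hγ zero_le_one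
      _ ≤ ENNReal.ofReal C * h.length γ 0 1 := hle
      _ < ε := by
        rw [mul_comm]
        exact ENNReal.mul_lt_of_lt_div (hl.trans_le (min_le_right _ _))
  obtain ⟨x, hx⟩ := hgR u hcauchy
  exact ⟨x, h.tendsto_riemEDist_iff.2 (gR.tendsto_riemEDist_iff.1 hx)⟩

end SmoothRiemannianMetric

end

theorem proposition3
    {E : Type*} [NormedAddCommGroup E] [NormedSpace ℝ E] [FiniteDimensional ℝ E]
    {M : Type*} [TopologicalSpace M] [ChartedSpace E M] [IsManifold 𝓘(ℝ, E) ∞ M]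
    [T2Space M] [ConnectedSpace M]
    (gR : SmoothRiemannianMetric E M) (hgR : gR.IsComplete) (x₀ : M) :
    -- a metric that is lowerly bounded through a primarily complete function is complete
    (∀ φ : ℝ → ℝ, IsBoundingFunction φ → IsPrimarilyComplete φ →
      ∀ h : SmoothRiemannianMetric E M, h.IsLowerlyBounded gR x₀ φ → h.IsComplete) ∧
    -- in particular, this occurs when the bounding function grows at most linearly
    (∀ φ : ℝ → ℝ, IsBoundingFunction φ →
      ∀ a b : ℝ, 0 ≤ a → 0 ≤ b → (∀ r : ℝ, 0 ≤ r → φ r ≤ a + b * r) →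
        IsPrimarilyComplete φ ∧
        ∀ h : SmoothRiemannianMetric E M,
          (h.IsLowerlyBounded gR x₀ φ → h.IsLowerlyBounded gR x₀ (fun r => a + b * r)) ∧
          (h.IsLowerlyBounded gR x₀ (fun r => a + b * r) → h.IsComplete)) := by
  -- Together with Hausdorffness this yields the `T3Space` instance.
  have : LocallyCompactSpace M := Manifold.locallyCompact_of_finiteDimensional 𝓘(ℝ, E)
  refine ⟨fun φ hφ hint h hb =>
    hb.isComplete hφ.pos hφ.locallyLipschitz.continuousOn hint hgR, fun φ hφ a b ha hb hle =>
    ⟨isPrimarilyComplete_of_le_linear hφ.pos ha hb hle, fun h =>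
      ⟨fun hl => hl.mono hφ.pos hle, fun hl => ?_⟩⟩⟩
  have hpos : ∀ r : ℝ, 0 ≤ r → 0 < a + b * r := fun r hr => (hφ.pos r hr).trans_le (hle r hr)
  exact hl.isComplete hpos (by fun_prop)
    (isPrimarilyComplete_of_le_linear hpos ha hb fun _ _ => le_rfl) hgR
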